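/- Let $X$ be a real reflexive Banach space, let $Z$ be a real Hausdorff topological vector space, let $C\subseteq Z$ be a convex and pointed cone with nonempty interior (that is, $C\neq\emptyset$, $tc\in C$ for all $c\in C$ and $t\ge 0$, $C+C=C$, $C\cap(-C)=\{0\}$ and $\operatorname{int}C\neq\emptyset$; $C$ need not be closed), and let $K$ be a nonempty, convex and closed subset of $X$. Let $F:K\times K\times K\to Z$ satisfy the following conditions. (i) For every $y\in K$, at least one of the following holds, where convergence and neighbourhoods in $X$ are taken in the weak topology of $X$: (a) for every net $(x_\alpha)\subseteq K$ with $\lim x_\alpha=x\in K$: if $F(x_\alpha,y,x_\alpha)\notin-\operatorname{int}C$ for all $\alpha$, then $F(x,y,x)\notin-\operatorname{int}C$; (b) the map $x\mapsto F(x,y,x)$ is $C$-upper semicontinuous on $K$: for every $x\in K$ and every neighbourhood $V$ of $F(x,y,x)$ there is a neighbourhood $U$ of $x$ such that $F(u,y,u)\in V-C$ for all $u\in U\cap K$; (c) for every $x\in K$ and every net $(x_\alpha)\subseteq K$ with $\lim x_\alpha=x$, there is a net $(z_\alpha)\subseteq Z$ with the same index set and a limit $z=\lim z_\alpha\in Z$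 such that $F(x_\alpha,y,x_\alpha)-z_\alpha\in-C$ for all $\alpha$ and $F(x,y,x)-z\in C$. (ii) For every $x\in K$, the map $f=F(x,\cdot,x)$ is $C$-convex on $K$: $tf(y_1)+(1-t)f(y_2)-f(ty_1+(1-t)y_2)\in C$ for all $y_1,y_2\in K$ and $t\in[0,1]$. (iii) For every $x\in K$, $F(x,x,x)\in(-C)\setminus(-\operatorname{int}C)$. (iv) There is $r>0$ such that $K\cap\{x\in X:\|x\|\le r\}\neq\emptyset$ and such that for every $x\in K$ with $\|x\|=r$ there exists $y_0\in K$ with $\|y_0\|<r$ and $F(x,y_0,x)\in-C$. Then there exists $x_0\in K$ such that $F(x_0,y,x_0)\notin-\operatorname{int}C$ for all $y\in K$. -/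

import Mathlib

open Filter Topology
open scoped Pointwise

universe u v

namespace WeakVectorEquilibrium

/-- `C` is a convex and pointed cone with nonempty interior: a nonempty set with `t • c ∈ C` for
`c ∈ C`, `t ≥ 0`, with `C + C = C`, with `C ∩ (-C) = {0}`, and with `int C ≠ ∅`.
The cone is not assumed to be closed. -/
structure IsSolidPointedConvexCone {Z : Type v} [AddCommGroup Z] [Module ℝ Z]
    [TopologicalSpace Z] (C : Set Z) : Prop where
  nonempty : C.Nonempty
  smul_mem : ∀ c ∈ C, ∀ t : ℝ, 0 ≤ t → t • c ∈ C
  add_eq : C + C = C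
  inter_neg : C ∩ (-C) = {0}
  interior_nonempty : (interior C).Nonempty

/-- `f` is `C`-convex on `K`. -/
def CConvexOn {X : Type u} {Z : Type v} [AddCommGroup X] [Module ℝ X] [AddCommGroup Z]
    [Module ℝ Z] (C : Set Z) (K : Set X) (f : X → Z) : Prop :=
  ∀ x ∈ K, ∀ y ∈ K, ∀ t : ℝ, 0 ≤ t → t ≤ 1 →
    t • f x + (1 - t) • f y - f (t • x + (1 - t) • y) ∈ C

/-- `f : K → Z` is `C`-upper semicontinuous at every point `x` of `K`: for every neighbourhood `V`
of `f x` there is a neighbourhood `U` of `x` with `f u ∈ V - C` for all `u ∈ U ∩ K`. -/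
def CUpperSemicontinuousOn {E : Type u} {Z : Type v} [TopologicalSpace E] [AddCommGroup Z]
    [TopologicalSpace Z] (C : Set Z) (K : Set E) (f : E → Z) : Prop :=
  ∀ x ∈ K, ∀ V ∈ 𝓝 (f x), ∃ U ∈ 𝓝 x, ∀ w ∈ U ∩ K, f w ∈ V - C

/-- For every net `(x_α)` in `K` with a limit `x` in `K`: if `f x_α ∉ -int C` for all `α`, then
`f x ∉ -int C`. Nets are families indexed by nonempty directed preorders. -/
def NetStableOn {E : Type u} {Z : Type v} [TopologicalSpace E] [AddCommGroup Z]
    [TopologicalSpace Z] (C : Set Z) (K : Set E) (f : E → Z) : Prop :=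
  ∀ (ι : Type u) [Preorder ι] [IsDirectedOrder ι] [Nonempty ι] (a : ι → E),
    (∀ i, a i ∈ K) → ∀ x ∈ K, Tendsto a atTop (𝓝 x) →
      (∀ i, f (a i) ∉ -interior C) → f x ∉ -interior C

/-- For every `x ∈ K` and every net `(x_α)` in `K` with limit `x` there is a net `(z_α)` in `Z`,
over the same index set, with a limit `z`, such that `f x_α - z_α ∈ -C` for all `α`, and
`f x - z ∈ C`. -/
def NetMajorizedOn {E : Type u} {Z : Type v} [TopologicalSpace E] [AddCommGroup Z]
    [TopologicalSpace Z] (C : Set Z) (K : Set E) (f : E → Z) : Prop :=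
  ∀ x ∈ K, ∀ (ι : Type u) [Preorder ι] [IsDirectedOrder ι] [Nonempty ι] (a : ι → E),
    (∀ i, a i ∈ K) → Tendsto a atTop (𝓝 x) →
      ∃ (b : ι → Z) (z : Z), Tendsto b atTop (𝓝 z) ∧
        (∀ i, f (a i) - b i ∈ -C) ∧ f x - z ∈ C

/-- One of the three closedness conditions holds for `f` on `K`, in the topology of `E`. -/
def ClosednessCondition {E : Type u} {Z : Type v} [TopologicalSpace E] [AddCommGroup Z]
    [TopologicalSpace Z] (C : Set Z) (K : Set E) (f : E → Z) : Prop :=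
  NetStableOn C K f ∨ CUpperSemicontinuousOn C K f ∨ NetMajorizedOn C K f

/-- The closedness condition for `f` on `K` with respect to the weak topology of `X`. -/
def WeakClosednessCondition {X : Type u} {Z : Type v} [NormedAddCommGroup X] [NormedSpace ℝ X]
    [AddCommGroup Z] [TopologicalSpace Z] (C : Set Z) (K : Set X) (f : X → Z) : Prop :=
  ClosednessCondition (E := WeakSpace ℝ X) C (toWeakSpace ℝ X '' K)
    (fun x => f ((toWeakSpace ℝ X).symm x))

/-- A real normed space is reflexive if its canonical map into the bidual is onto. -/
def IsReflexiveSpace (X : Type u) [NormedAddCommGroup X] [NormedSpace ℝ X] : Prop :=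
  Function.Surjective (NormedSpace.inclusionInDoubleDual ℝ X)

end WeakVectorEquilibrium

-- Let `B` be the part of `K` in the closed ball of radius `r`; it is weakly compact by reflexivity.
-- For `y ∈ B` the set of `x ∈ B` with `F x y x ∉ -interior C` is weakly closed, since each of the
-- conditions (b), (c) implies (a). These sets satisfy the KKM condition: if a convex combination
-- `x` of points `y` lay in none of their sets, `C`-convexity would give `F x x x ∈ -interior C`.
-- Fan's KKM lemma yields a solution `x₀` on `B`. Coercivity, or `x₀` itself if `‖x₀‖ < r`, supplies
-- `y₀` in the open ball with `F x₀ y₀ x₀ ∈ -C`. A violation at some `y ∈ K` would spread along the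
-- segment from `y` to `y₀` and so reach `B`. All cone steps rest on `interior C + C ⊆ interior C`,
-- which needs no closedness of `C`. Fan's lemma reduces by compactness to the KKM lemma on a
-- simplex, which follows from Brouwer's theorem. Brouwer's theorem comes from Scarf's lemma, a
-- parity argument on dominant sets, applied to finer and finer grids.

/-! ### Scarf's lemma -/

namespace Scarf

variable {I V α : Type*} [LinearOrder α]

/-- Given a family of rankings `r i` of `V`, the finite set `S` is dominant if no element of `V`
lies strictly above some element of `S` in every ranking. -/
def Dominant (r : I → V → α) (S : Finset V) : Prop :=
  ∀ y, ∃ i, ∀ s ∈ S, r i y ≤ r i s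

/-- `m i` is a least element of `S` in the ranking `r i`, for every `i`. -/
def IsArgmin (r : I → V → α) (S : Finset V) (m : I → V) : Prop :=
  ∀ i, m i ∈ S ∧ ∀ s ∈ S, r i (m i) ≤ r i s

/-- The elements lying strictly above `m i` in the ranking `r i`, for all `i ≠ k`. -/
def Above (r : I → V → α) (m : I → V) (k : I) : Set V :=
  {y | ∀ l, l ≠ k → r l (m l) < r l y}

theorem exists_isArgmin (r : I → V → α) {S : Finset V} (hS : S.Nonempty) :
    ∃ m, IsArgmin r S m := by
  choose m hm using fun i => S.exists_min_image (r i) hS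
  exact ⟨m, hm⟩

variable {r : I → V → α} {S : Finset V} {m : I → V}

theorem Dominant.mono {S' : Finset V} (h : Dominant r S) (hS : S' ⊆ S) : Dominant r S' := by
  intro y
  obtain ⟨i, hi⟩ := h y
  exact ⟨i, fun s hs => hi s (hS hs)⟩

/-- Dominance tested at `y ∈ S` itself gives a ranking in which `y` is least in `S`. -/
theorem Dominant.exists_argmin_eq (hr : ∀ i, Function.Injective (r i)) (h : Dominant r S)
    (hm : IsArgmin r S m) {y : V} (hy : y ∈ S) : ∃ i, m i = y := by
  obtain ⟨i, hi⟩ := h y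
  exact ⟨i, hr i (le_antisymm ((hm i).2 y hy) (hi _ (hm i).1))⟩

theorem Dominant.injective_argmin [Fintype I] [DecidableEq V]
    (hr : ∀ i, Function.Injective (r i))
    (h : Dominant r S) (hm : IsArgmin r S m) (hcard : S.card = Fintype.card I) :
    Function.Injective m := by
  have himg : Finset.univ.image m = S := by
    ext y
    simp only [Finset.mem_image, Finset.mem_univ, true_and]
    exact ⟨by rintro ⟨i, rfl⟩; exact (hm i).1, fun hy => h.exists_argmin_eq hr hm hy⟩
  have : Set.InjOn m (Finset.univ : Finset I) := by
    rw [← Finset.card_image_iff, himg, hcard, Finset.card_univ]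
  simpa using this

theorem exists_ne_argmin_eq [Fintype I] (hm : IsArgmin r S m)
    (hcard : S.card + 1 = Fintype.card I) : ∃ i j, i ≠ j ∧ m i = m j := by
  obtain ⟨i, -, j, -, hij, h⟩ := Finset.exists_ne_map_eq_of_card_lt_of_maps_to
    (s := Finset.univ) (t := S) (f := m) (by rw [Finset.card_univ]; omega) (fun i _ => (hm i).1)
  exact ⟨i, j, hij, h⟩

/-- A common element would lie strictly above `m l` in every ranking `l`, against dominance. -/
theorem Dominant.above_disjoint (h : Dominant r S) (hm : IsArgmin r S m) {i j : I} (hij : i ≠ j)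
    {y : V} (hi : y ∈ Above r m i) (hj : y ∈ Above r m j) : False := by
  obtain ⟨l, hl⟩ := h y
  have h1 := hl _ (hm l).1
  by_cases hli : l = i
  · exact (h1.trans_lt (hj l (hli ▸ hij))).false
  · exact (h1.trans_lt (hi l hli)).false

/-- If `insert y S` is dominant, then `y` is the greatest element of one of two sets `Above`. -/
theorem Dominant.isGreatest_of_insert [Fintype I] [DecidableEq V]
    (hr : ∀ i, Function.Injective (r i))
    (hm : IsArgmin r S m) (hcard : S.card + 1 = Fintype.card I) {i j : I} (hij : i ≠ j)
    (hmij : m i = m j) {y : V} (hy : y ∉ S) (hins : Dominant r (insert y S)) :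
    ∃ k, (k = i ∨ k = j) ∧ y ∈ Above r m k ∧ ∀ z ∈ Above r m k, r k z ≤ r k y := by
  obtain ⟨m', hm'⟩ := exists_isArgmin r (S.insert_nonempty y)
  have hinj := hins.injective_argmin hr hm' (by rw [Finset.card_insert_of_notMem hy, hcard])
  obtain ⟨k, hk⟩ := hins.exists_argmin_eq hr hm' (Finset.mem_insert_self y S)
  have hS' : ∀ l, l ≠ k → m' l ∈ S := fun l hl =>
    (Finset.mem_insert.1 (hm' l).1).resolve_left fun h => hl (hinj (h.trans hk.symm))
  have heq : ∀ l, l ≠ k → m' l = m l := fun l hl =>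
    hr l (le_antisymm ((hm' l).2 _ (Finset.mem_insert_of_mem (hm l).1)) ((hm l).2 _ (hS' l hl)))
  have hAb : y ∈ Above r m k := by
    intro l hl
    refine lt_of_le_of_ne ?_ fun h => hy ?_
    · rw [← heq l hl]; exact (hm' l).2 _ (Finset.mem_insert_self y S)
    · rw [← hr l h]; exact (hm l).1
  refine ⟨k, ?_, hAb, fun z hz => ?_⟩
  -- Otherwise `m' i = m i = m j = m' j`, against injectivity of `m'`.
  · by_contra! hne
    exact hij (hinj ((heq i hne.1.symm).trans (hmij.trans (heq j hne.2.symm).symm)))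
  · obtain ⟨l, hl⟩ := hins z
    by_cases hlk : l = k
    · subst hlk; exact hl y (Finset.mem_insert_self y S)
    · exact absurd (hl _ (Finset.mem_insert_of_mem (hm l).1)) (hz l hlk).not_ge

/-- Because `m i = m j`, every element of `S` is `m l` for some `l ≠ k`, and `y` cannot lie strictly
above itself. -/
theorem Dominant.notMem_of_mem_above (hr : ∀ i, Function.Injective (r i)) (h : Dominant r S)
    (hm : IsArgmin r S m) {i j k : I} (hij : i ≠ j) (hmij : m i = m j) (hk : k = i ∨ k = j) {y : V}
    (hy : y ∈ Above r m k) : y ∉ S := by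
  intro hyS
  obtain ⟨l, rfl⟩ := h.exists_argmin_eq hr hm hyS
  have : ∃ l', l' ≠ k ∧ m l' = m l := by
    by_cases hlk : l = k
    · rcases hk with hk | hk
      · exact ⟨j, by rw [hk]; exact hij.symm, by rw [hlk, hk, hmij]⟩
      · exact ⟨i, by rw [hk]; exact hij, by rw [hlk, hk, hmij]⟩
    · exact ⟨l, hlk, rfl⟩
  obtain ⟨l', hl', he⟩ := this
  have := hy l' hl'
  rw [he] at this
  exact this.false

/-- An element of `Above r m k` is dominated in ranking `k`. Any other fails to exceed `m l` for
some `l ≠ k`, and `m l` stays least in ranking `l` after `y` is inserted. -/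
theorem Dominant.insert_of_isGreatest [DecidableEq V] (h : Dominant r S) (hm : IsArgmin r S m)
    {k : I} {y : V} (hy : y ∈ Above r m k) (hmax : ∀ z ∈ Above r m k, r k z ≤ r k y) :
    Dominant r (insert y S) := by
  intro z
  by_cases hz : z ∈ Above r m k
  · have hyk : r k y ≤ r k (m k) := by
      obtain ⟨l, hl⟩ := h y
      by_cases hlk : l = k
      · subst hlk; exact hl _ (hm l).1
      · exact absurd (hl _ (hm l).1) (hy l hlk).not_ge
    refine ⟨k, fun s hs => ?_⟩
    rcases Finset.mem_insert.1 hs with rfl | hs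
    · exact hmax z hz
    · exact ((hmax z hz).trans hyk).trans ((hm k).2 s hs)
  · simp only [Above, Set.mem_ofPred_eq, not_forall, not_lt] at hz
    obtain ⟨l, hlk, hl⟩ := hz
    refine ⟨l, fun s hs => hl.trans ?_⟩
    rcases Finset.mem_insert.1 hs with rfl | hs
    · exact (hy l hlk).le
    · exact (hm l).2 s hs

-- Parity count of dominant sets

section Count

variable [Fintype I] [Fintype V] [DecidableEq V]

open Classical in
/-- The elements whose insertion into `S` yields a dominant set. -/
noncomputable def completions (r : I → V → α) (S : Finset V) : Finset V :=
  Finset.univ.filter fun y => y ∉ S ∧ Dominant r (insert y S)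

omit [Fintype I] in
theorem mem_completions {y : V} : y ∈ completions r S ↔ y ∉ S ∧ Dominant r (insert y S) := by
  simp [completions]

theorem Dominant.mem_completions_iff (hr : ∀ i, Function.Injective (r i)) (h : Dominant r S)
    (hm : IsArgmin r S m) (hcard : S.card + 1 = Fintype.card I) {i j : I} (hij : i ≠ j)
    (hmij : m i = m j) {y : V} :
    y ∈ completions r S ↔
      ∃ k, (k = i ∨ k = j) ∧ y ∈ Above r m k ∧ ∀ z ∈ Above r m k, r k z ≤ r k y := by
  rw [mem_completions]
  constructor
  · rintro ⟨hy, hins⟩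
    exact hins.isGreatest_of_insert hr hm hcard hij hmij hy
  · rintro ⟨k, hk, hy, hmax⟩
    exact ⟨h.notMem_of_mem_above hr hm hij hmij hk hy, h.insert_of_isGreatest hm hy hmax⟩

omit [DecidableEq V] [Fintype I] in
theorem exists_greatest_above {k : I} (hne : (Above r m k).Nonempty) :
    ∃ y ∈ Above r m k, ∀ z ∈ Above r m k, r k z ≤ r k y :=
  Set.exists_max_image _ (r k) (Set.toFinite _) hne

theorem Dominant.card_completions_eq_two (hr : ∀ i, Function.Injective (r i)) (h : Dominant r S)
    (hm : IsArgmin r S m) (hcard : S.card + 1 = Fintype.card I) {i j : I} (hij : i ≠ j)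
    (hmij : m i = m j) (hi : (Above r m i).Nonempty) (hj : (Above r m j).Nonempty) :
    (completions r S).card = 2 := by
  obtain ⟨a, ha, hamax⟩ := exists_greatest_above hi
  obtain ⟨b, hb, hbmax⟩ := exists_greatest_above hj
  rw [Finset.card_eq_two]
  refine ⟨a, b, fun hab => h.above_disjoint hm hij ha (hab ▸ hb), ?_⟩
  ext y
  rw [h.mem_completions_iff hr hm hcard hij hmij, Finset.mem_insert, Finset.mem_singleton]
  constructor
  · rintro ⟨k, rfl | rfl, hy, hmax⟩
    · exact Or.inl (hr _ (le_antisymm (hamax y hy) (hmax a ha)))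
    · exact Or.inr (hr _ (le_antisymm (hbmax y hy) (hmax b hb)))
  · rintro (rfl | rfl)
    · exact ⟨i, Or.inl rfl, ha, hamax⟩
    · exact ⟨j, Or.inr rfl, hb, hbmax⟩

theorem Dominant.card_completions_eq_one (hr : ∀ i, Function.Injective (r i)) (h : Dominant r S)
    (hm : IsArgmin r S m) (hcard : S.card + 1 = Fintype.card I) {i j : I} (hij : i ≠ j)
    (hmij : m i = m j) (hi : (Above r m i).Nonempty) (hj : Above r m j = ∅) :
    (completions r S).card = 1 := by
  obtain ⟨a, ha, hamax⟩ := exists_greatest_above hi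
  rw [Finset.card_eq_one]
  refine ⟨a, ?_⟩
  ext y
  rw [h.mem_completions_iff hr hm hcard hij hmij, Finset.mem_singleton]
  constructor
  · rintro ⟨k, rfl | rfl, hy, hmax⟩
    · exact hr _ (le_antisymm (hamax y hy) (hmax a ha))
    · simp [hj] at hy
  · rintro rfl
    exact ⟨i, Or.inl rfl, ha, hamax⟩

variable [DecidableEq I]

omit [Fintype V] in
/-- The number of facets of `S` coloured exactly by the colours other than `i₀` is even, unless
all colours occur in `S`. -/
theorem even_card_facets (c : V → I) (i₀ : I) (hcard : S.card = Fintype.card I)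
    (hS : S.image c ≠ Finset.univ) :
    Even (S.filter fun v => (S.erase v).image c = Finset.univ.erase i₀).card := by
  by_cases hne : (S.filter fun v => (S.erase v).image c = Finset.univ.erase i₀) = ∅
  · simp [hne]
  obtain ⟨v, hv⟩ := Finset.nonempty_iff_ne_empty.2 hne
  obtain ⟨hvS, hv⟩ := Finset.mem_filter.1 hv
  have hinj : Set.InjOn c (S.erase v : Finset V) := by
    rw [← Finset.card_image_iff, hv, Finset.card_erase_of_mem hvS, hcard,
      Finset.card_erase_of_mem (Finset.mem_univ _), Finset.card_univ]
  have hcv : c v ≠ i₀ := by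
    intro hc
    apply hS
    rw [← Finset.insert_erase hvS, Finset.image_insert, hv, hc,
      Finset.insert_erase (Finset.mem_univ _)]
  have hcv' : c v ∈ (S.erase v).image c := by
    rw [hv]; exact Finset.mem_erase.2 ⟨hcv, Finset.mem_univ _⟩
  obtain ⟨w, hw, hcw⟩ := Finset.mem_image.1 hcv'
  obtain ⟨hwv, hwS⟩ := Finset.mem_erase.1 hw
  -- The colour of `v` occurs exactly once more in `S`, at `w`; only deleting one of these two keeps
  -- all colours other than `i₀`.
  suffices (S.filter fun v => (S.erase v).image c = Finset.univ.erase i₀) = {v, w} by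
    rw [this, Finset.card_pair hwv.symm]; exact even_two
  ext u
  rw [Finset.mem_filter, Finset.mem_insert, Finset.mem_singleton]
  constructor
  · rintro ⟨huS, hu⟩
    by_contra! hne
    have hcu : c u ∈ (S.erase u).image c := by
      rw [hu, ← hv]
      exact Finset.mem_image_of_mem c (Finset.mem_erase.2 ⟨hne.1, huS⟩)
    obtain ⟨x, hx, hcx⟩ := Finset.mem_image.1 hcu
    obtain ⟨hxu, hxS⟩ := Finset.mem_erase.1 hx
    have huv : u ∈ ((S.erase v : Finset V) : Set V) := by simp [hne.1, huS]
    by_cases hxv : x = v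
    · exact hne.2 (hinj huv hw (by rw [hcw, ← hcx, hxv]))
    · exact hxu (hinj (by simp [hxv, hxS]) huv hcx)
  · rintro (rfl | rfl)
    · exact ⟨hvS, hv⟩
    · refine ⟨hwS, ?_⟩
      rw [← hv, ← Finset.insert_erase (Finset.mem_erase.2 ⟨hwv, hwS⟩),
        ← Finset.insert_erase (Finset.mem_erase.2 ⟨hwv.symm, hvS⟩), Finset.image_insert,
        Finset.image_insert, hcw, Finset.erase_right_comm]

/-- Slack elements: `e i` is the least element of the ranking `r i`, and it lies above all
non-slack elements in the other rankings. -/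
structure IsSlack (r : I → V → α) (e : I → V) : Prop where
  injective : Function.Injective e
  least : ∀ i v, r i (e i) ≤ r i v
  above : ∀ i k v, k ≠ i → v ∉ Set.range e → r i v < r i (e k)

variable {e : I → V} {i₀ : I}

omit [Fintype I] [Fintype V] [DecidableEq I] [DecidableEq V] in
theorem IsSlack.lt (he : IsSlack r e) (hr : ∀ i, Function.Injective (r i)) {i : I} {v : V}
    (h : v ≠ e i) : r i (e i) < r i v :=
  lt_of_le_of_ne (he.least i v) fun hn => h (hr i hn).symm

omit [Fintype V] in
-- The only danger is `m l = e a` with `a ≠ l`. Non-slack elements lie below `e a` in ranking `l`,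
-- so `S` would consist of slack elements, and its colours would make it the excluded facet.
theorem IsSlack.argmin_lt (he : IsSlack r e) (hr : ∀ i, Function.Injective (r i))
    {c : V → I} (hc : ∀ i, c (e i) = i) (hm : IsArgmin r S m)
    (hS : S.image c = Finset.univ.erase i₀) (hS' : S ≠ (Finset.univ.erase i₀).image e)
    {l k : I} (hlk : l ≠ k) : r l (m l) < r l (e k) := by
  by_cases hrange : m l ∈ Set.range e
  · obtain ⟨a, ha⟩ := hrange
    by_cases hal : a = l
    · rw [← ha, hal]
      exact he.lt hr fun h => hlk (he.injective h).symm
    · exfalso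
      have hsub : ∀ s ∈ S, s ∈ Set.range e := by
        intro s hs
        by_contra hn
        exact (he.above l a s hal hn).not_ge (ha ▸ (hm l).2 s hs)
      apply hS'
      rw [← hS, Finset.image_image]
      symm
      calc S.image (e ∘ c) = S.image id := Finset.image_congr (by
            intro s hs
            obtain ⟨b, rfl⟩ := hsub s hs
            simp [hc])
        _ = S := Finset.image_id
  · exact he.above l k _ hlk.symm hrange

omit [Fintype V] in
theorem IsSlack.above_nonempty (he : IsSlack r e) (hr : ∀ i, Function.Injective (r i))
    {c : V → I} (hc : ∀ i, c (e i) = i) (hm : IsArgmin r S m)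
    (hS : S.image c = Finset.univ.erase i₀) (hS' : S ≠ (Finset.univ.erase i₀).image e) (i : I) :
    (Above r m i).Nonempty :=
  ⟨e i, fun _ hl => he.argmin_lt hr hc hm hS hS' hl⟩

omit [Fintype V] in
theorem IsSlack.dominant_facet (he : IsSlack r e) (i₀ : I) :
    Dominant r ((Finset.univ.erase i₀).image e) := by
  intro y
  by_cases hy : y ∈ Set.range e
  · obtain ⟨k, rfl⟩ := hy
    exact ⟨k, fun s _ => he.least k s⟩
  · refine ⟨i₀, fun s hs => ?_⟩
    obtain ⟨k, hk, rfl⟩ := Finset.mem_image.1 hs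
    exact (he.above i₀ k y (Finset.ne_of_mem_erase hk) hy).le

omit [Fintype V] in
theorem IsSlack.card_facet (he : IsSlack r e) (i₀ : I) :
    ((Finset.univ.erase i₀).image e).card + 1 = Fintype.card I := by
  rw [Finset.card_image_of_injective _ he.injective,
    Finset.card_erase_add_one (Finset.mem_univ _), Finset.card_univ]

/-- The repeated minimum is `e k`, least in the rankings `k` and `i₀`. On the `i₀` side `e i₀` is
available; on the `k` side nothing is, so this is the boundary door of the parity argument. -/
theorem IsSlack.card_completions_facet [Nontrivial I] (he : IsSlack r e)
    (hr : ∀ i, Function.Injective (r i)) (i₀ : I) :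
    (completions r ((Finset.univ.erase i₀).image e)).card = 1 := by
  obtain ⟨k₀, hk₀⟩ := exists_ne i₀
  have hmem : ∀ l, l ≠ i₀ → e l ∈ (Finset.univ.erase i₀).image e := fun l hl =>
    Finset.mem_image_of_mem e (Finset.mem_erase.2 ⟨hl, Finset.mem_univ _⟩)
  obtain ⟨m, hm⟩ := exists_isArgmin r ⟨_, hmem k₀ hk₀⟩
  have hml : ∀ l, l ≠ i₀ → m l = e l := fun l hl =>
    hr l (le_antisymm ((hm l).2 _ (hmem l hl)) (he.least l _))
  obtain ⟨k, hk, hmk⟩ := Finset.mem_image.1 (hm i₀).1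
  have hki : k ≠ i₀ := Finset.ne_of_mem_erase hk
  refine (he.dominant_facet i₀).card_completions_eq_one hr hm (he.card_facet i₀) hki.symm
    (by rw [← hmk, hml k hki]) ⟨e i₀, fun l hl => ?_⟩ ?_
  · rw [hml l hl]
    exact he.lt hr fun h => hl (he.injective h).symm
  · refine Set.eq_empty_iff_forall_notMem.2 fun y hy => ?_
    have h0 := hy i₀ hki.symm
    rw [← hmk] at h0
    by_cases hyr : y ∈ Set.range e
    · obtain ⟨a, rfl⟩ := hyr
      by_cases hak : a = k
      · exact (hak ▸ h0).false
      · have h1 := hy a hak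
        by_cases hai : a = i₀
        · exact (hai ▸ h0).not_ge (he.least i₀ _)
        · rw [hml a hai] at h1
          exact h1.false
    · exact h0.not_gt (he.above i₀ k y hki hyr)

/-- **Scarf's lemma**: for every colouring that is the identity on slack elements there is a
dominant set in which every colour occurs exactly once. -/
theorem IsSlack.exists_rainbow [Nontrivial I] (he : IsSlack r e)
    (hr : ∀ i, Function.Injective (r i)) (c : V → I) (hc : ∀ i, c (e i) = i) :
    ∃ S : Finset V, Dominant r S ∧ S.card = Fintype.card I ∧ S.image c = Finset.univ := by
  classical
  by_contra! hno
  obtain ⟨i₀⟩ : Nonempty I := inferInstance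
  -- Incidences of doors and rooms are counted twice. Without a rainbow room each room has an even
  -- number of doors, while every door lies in two rooms except the slack facet, which lies in one.
  let rooms : Finset (Finset V) :=
    Finset.univ.filter fun S => Dominant r S ∧ S.card = Fintype.card I
  let doors : Finset (Finset V) :=
    Finset.univ.filter fun S => Dominant r S ∧ S.image c = Finset.univ.erase i₀ ∧
      S.card + 1 = Fintype.card I
  have hcount := Finset.sum_card_bipartiteAbove_eq_sum_card_bipartiteBelow
    (s := doors) (t := rooms) (fun D S => D ⊆ S)
  have hbelow : ∀ S ∈ rooms, Even (doors.bipartiteBelow (fun D S => D ⊆ S) S).card := by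
    intro S hS
    obtain ⟨-, hS, hcard⟩ := Finset.mem_filter.1 hS
    have : doors.bipartiteBelow (fun D S => D ⊆ S) S =
        (S.filter fun v => (S.erase v).image c = Finset.univ.erase i₀).image S.erase := by
      ext D
      simp only [Finset.mem_bipartiteBelow, doors, Finset.mem_filter, Finset.mem_univ, true_and,
        Finset.mem_image]
      constructor
      · rintro ⟨⟨hD, hDc, hDcard⟩, hDS⟩
        obtain ⟨v, hv, rfl⟩ : ∃ v ∈ S, S.erase v = D := by
          obtain ⟨v, hv, h⟩ := Finset.exists_eq_insert_iff.2 ⟨hDS, by omega⟩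
          exact ⟨v, by rw [← h]; exact Finset.mem_insert_self _ _,
            by rw [← h, Finset.erase_insert hv]⟩
        exact ⟨v, ⟨hv, hDc⟩, rfl⟩
      · rintro ⟨v, ⟨hv, hvc⟩, rfl⟩
        exact ⟨⟨hS.mono (Finset.erase_subset _ _), hvc, by
          rw [Finset.card_erase_add_one hv, hcard]⟩, Finset.erase_subset _ _⟩
    rw [this, Finset.card_image_of_injOn
      ((Finset.erase_injOn S).mono (Finset.coe_subset.2 (Finset.filter_subset _ _)))]
    exact even_card_facets c i₀ hcard (hno S hS hcard)
  have habove : ∀ D ∈ doors,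
      (rooms.bipartiteAbove (fun D S => D ⊆ S) D).card = (completions r D).card := by
    intro D hD
    obtain ⟨-, hD, -, hcard⟩ := Finset.mem_filter.1 hD
    have : rooms.bipartiteAbove (fun D S => D ⊆ S) D =
        (completions r D).image fun y => insert y D := by
      ext S
      simp only [Finset.mem_bipartiteAbove, rooms, Finset.mem_filter, Finset.mem_univ, true_and,
        Finset.mem_image, mem_completions]
      constructor
      · rintro ⟨⟨hS, hScard⟩, hDS⟩
        obtain ⟨v, hv, rfl⟩ := Finset.exists_eq_insert_iff.2 ⟨hDS, by omega⟩
        exact ⟨v, ⟨hv, hS⟩, rfl⟩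
      · rintro ⟨y, ⟨hy, hyD⟩, rfl⟩
        exact ⟨⟨hyD, by rw [Finset.card_insert_of_notMem hy, hcard]⟩, Finset.subset_insert _ _⟩
    rw [this, Finset.card_image_of_injOn]
    intro y hy z hz hyz
    exact (Finset.insert_inj (mem_completions.1 hy).1).1 hyz
  have hmem : (Finset.univ.erase i₀).image e ∈ doors := by
    refine Finset.mem_filter.2 ⟨Finset.mem_univ _, he.dominant_facet i₀, ?_, he.card_facet i₀⟩
    rw [Finset.image_image, show c ∘ e = id from funext hc, Finset.image_id]
  have hodd : Odd (∑ D ∈ doors, (rooms.bipartiteAbove (fun D S => D ⊆ S) D).card) := by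
    rw [← Finset.add_sum_erase _ _ hmem, habove _ hmem, he.card_completions_facet hr i₀]
    refine odd_one.add_even (Finset.even_sum _ fun D hD => ?_)
    obtain ⟨hDne, hD⟩ := Finset.mem_erase.1 hD
    rw [habove D hD]
    obtain ⟨-, hD, hDc, hcard⟩ := Finset.mem_filter.1 hD
    have hne : D.Nonempty := by
      rw [← Finset.card_pos]
      have := Fintype.one_lt_card (α := I)
      omega
    obtain ⟨m, hm⟩ := exists_isArgmin r hne
    obtain ⟨i, j, hij, hmij⟩ := exists_ne_argmin_eq hm hcard
    rw [hD.card_completions_eq_two hr hm hcard hij hmij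
      (he.above_nonempty hr hc hm hDc hDne i) (he.above_nonempty hr hc hm hDc hDne j)]
    exact even_two
  rw [hcount] at hodd
  exact Nat.not_even_iff_odd.2 hodd (Finset.even_sum _ hbelow)

end Count

end Scarf

/-! ### Brouwer's fixed point theorem and the KKM lemma on the standard simplex -/

section Brouwer

variable {I : Type*} [Fintype I] [DecidableEq I]

/-- For every colouring of the integer points of the simplex of size `N` by its vertices there are
mutually close points, one for each `i`, of colour `i` or close to the face opposite to `i`. -/
theorem Scarf.exists_close_points [Nontrivial I] (N : ℕ) (c : (I → ℕ) → I) :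
    ∃ x : I → I → ℕ, (∀ i, ∑ k, x i k = N) ∧
      (∀ i j k, x i k ≤ x j k + Fintype.card I) ∧
      ∀ i, c (x i) = i ∨ x i i ≤ Fintype.card I := by
  classical
  set n := Fintype.card I with hn
  let T := {x : I → ℕ // x ∈ Finset.piAntidiag Finset.univ N}
  let _ : Fintype T := inferInstanceAs (Fintype (Finset.piAntidiag (Finset.univ : Finset I) N))
  have hT : ∀ x : T, ∑ k, x.1 k = N := fun x => (Finset.mem_piAntidiag.1 x.2).1
  have mkT : ∀ y : I → ℕ, ∑ k, y k = N → y ∈ Finset.piAntidiag Finset.univ N := fun y hy =>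
    Finset.mem_piAntidiag.2 ⟨hy, fun _ _ => Finset.mem_univ _⟩
  let idx : T ⊕ I → ℕ := fun v => (Fintype.equivFin (T ⊕ I) v : ℕ)
  have hidx : Function.Injective idx := fun a b h =>
    (Fintype.equivFin (T ⊕ I)).injective (Fin.ext h)
  -- Grid points get heights from `1` to `N + 1`, strictly between the slack heights `0` and `N +
  -- 2`; `idx` breaks ties.
  let height : I → T ⊕ I → ℕ := fun i v =>
    Sum.elim (fun x : T => x.1 i + 1) (fun k => if k = i then 0 else N + 2) v
  let r : I → T ⊕ I → ℕ ×ₗ ℕ := fun i v => toLex (height i v, idx v)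
  have hr : ∀ i, Function.Injective (r i) := by
    intro i a b h
    exact hidx (congrArg Prod.snd (toLex.injective h))
  have hlt : ∀ i a b, height i a < height i b → r i a < r i b := fun i a b h =>
    Prod.Lex.toLex_lt_toLex.2 (Or.inl h)
  have hle : ∀ i a b, r i a ≤ r i b → height i a ≤ height i b := by
    intro i a b h
    by_contra! hn
    exact h.not_gt (hlt i b a hn)
  have he : Scarf.IsSlack r (Sum.inr : I → T ⊕ I) := by
    refine ⟨Sum.inr_injective, fun i v => ?_, fun i k v hk hv => ?_⟩
    · by_cases h : v = Sum.inr i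
      · rw [h]
      · refine (hlt _ _ _ ?_).le
        rcases v with x | k
        · simp [height]
        · have : k ≠ i := fun hk => h (by rw [hk])
          simp [height, this]
    · apply hlt
      rcases v with x | k'
      · have : x.1 i ≤ N :=
          (Finset.single_le_sum (fun _ _ => Nat.zero_le _) (Finset.mem_univ i)).trans_eq (hT x)
        simp [height, hk]; omega
      · simp at hv
  obtain ⟨S, hdom, hcard, himg⟩ := he.exists_rainbow hr
    (Sum.elim (fun x : T => c x.1) id) (fun i => rfl)
  obtain ⟨i₁, hi₁⟩ : ∃ i₁, (Sum.inr i₁ : T ⊕ I) ∉ S := by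
    by_contra! hall
    obtain ⟨i⟩ : Nonempty I := inferInstance
    obtain ⟨k, hk⟩ := hdom (Sum.inl ⟨Pi.single i N, mkT _ (by simp)⟩)
    have := hle _ _ _ (hk _ (hall k))
    simp [height] at this
  have hcol : ∀ i, Sum.inr i ∉ S → ∃ x : T, Sum.inl x ∈ S ∧ c x.1 = i := by
    intro i hi
    have : i ∈ S.image (Sum.elim (fun x : T => c x.1) id) := by
      rw [himg]; exact Finset.mem_univ i
    obtain ⟨v, hv, hvi⟩ := Finset.mem_image.1 this
    rcases v with x | k
    · exact ⟨x, hv, hvi⟩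
    · obtain rfl : k = i := hvi
      exact absurd hv hi
  obtain ⟨x₁, hx₁, -⟩ := hcol i₁ hi₁
  have hmin : ∀ i, ∃ w : T, Sum.inl w ∈ S ∧ ∀ x : T, Sum.inl x ∈ S → w.1 i ≤ x.1 i := by
    intro i
    obtain ⟨w, hw, hmin⟩ := Finset.exists_min_image (Finset.univ.filter fun x : T => Sum.inl x ∈ S)
      (fun x => x.1 i) ⟨x₁, by simp [hx₁]⟩
    exact ⟨w, (Finset.mem_filter.1 hw).2, fun x hx => hmin x (by simp [hx])⟩
  choose w hwS hw using hmin
  let D : Finset I := Finset.univ.filter fun i => (Sum.inr i : T ⊕ I) ∉ S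
  have hD : ∀ i, i ∈ D ↔ (Sum.inr i : T ⊕ I) ∉ S := fun i => by simp [D]
  -- Otherwise raising every minimum over `D` by one, and putting the remainder on `i₁`, gives a
  -- grid point above `S` in every ranking. For `i ∉ D` the slack element of height `0` lies in `S`.
  have hsum : N < ∑ i ∈ D, ((w i).1 i + 1) := by
    by_contra! hcon
    have hi₁D := (hD i₁).2 hi₁
    let y : I → ℕ := fun i => (if i ∈ D then (w i).1 i + 1 else 0) +
      if i = i₁ then N - ∑ i ∈ D, ((w i).1 i + 1) else 0
    have hy : ∑ i, y i = N := by
      simp only [y, Finset.sum_add_distrib, Finset.sum_ite_mem, Finset.univ_inter,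
        Finset.sum_ite_eq', Finset.mem_univ, if_true] at hcon ⊢
      omega
    obtain ⟨i, hi⟩ := hdom (Sum.inl ⟨y, mkT y hy⟩)
    by_cases hiD : i ∈ D
    · have := hle _ _ _ (hi _ (hwS i))
      simp [height, y, hiD] at this
      omega
    · have := hle _ _ _ (hi (Sum.inr i) (by rw [hD] at hiD; simpa using hiD))
      simp [height] at this
  have hDn : D.card ≤ n := Finset.card_le_univ D
  rw [Finset.sum_add_distrib, Finset.sum_const, smul_eq_mul, mul_one] at hsum
  -- By `hsum` the minima over `D` add up to more than `N - n`, which leaves at most `n` for any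
  -- excess over them and for any coordinate outside `D`.
  have hout : ∀ x : T, Sum.inl x ∈ S → ∀ k, k ∉ D → x.1 k ≤ n := by
    intro x hx k hk
    have h1 : ∑ i ∈ D, (w i).1 i ≤ ∑ i ∈ D, x.1 i := Finset.sum_le_sum fun i _ => hw i x hx
    have h2 : x.1 k + ∑ i ∈ D, x.1 i ≤ N := by
      rw [← Finset.sum_insert hk]
      exact (Finset.sum_le_sum_of_subset (Finset.subset_univ _)).trans_eq (hT x)
    omega
  have hin : ∀ x : T, Sum.inl x ∈ S → ∀ k, k ∈ D → x.1 k ≤ (w k).1 k + n := by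
    intro x hx k hk
    have h1 : ∑ i ∈ D.erase k, (w i).1 i ≤ ∑ i ∈ D.erase k, x.1 i :=
      Finset.sum_le_sum fun i _ => hw i x hx
    have h2 : ∑ i ∈ D, x.1 i ≤ N :=
      (Finset.sum_le_sum_of_subset (Finset.subset_univ _)).trans_eq (hT x)
    rw [← Finset.add_sum_erase _ _ hk] at h2 hsum
    omega
  have hclose : ∀ x y : T, Sum.inl x ∈ S → Sum.inl y ∈ S → ∀ k, x.1 k ≤ y.1 k + n := by
    intro x y hx hy k
    by_cases hk : k ∈ D
    · exact (hin x hx k hk).trans (Nat.add_le_add_right (hw k y hy) n)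
    · exact (hout x hx k hk).trans (Nat.le_add_left _ _)
  have hpt : ∀ i, ∃ x : T, Sum.inl x ∈ S ∧ (c x.1 = i ∨ x.1 i ≤ n) := by
    intro i
    by_cases hi : i ∈ D
    · obtain ⟨x, hx, hxi⟩ := hcol i ((hD i).1 hi)
      exact ⟨x, hx, Or.inl hxi⟩
    · exact ⟨x₁, hx₁, Or.inr (hout x₁ hx₁ i hi)⟩
  choose x hxS hx using hpt
  exact ⟨fun i => (x i).1, fun i => hT (x i), fun i j k => hclose _ _ (hxS i) (hxS j) k, hx⟩

/-- **Brouwer's fixed point theorem** for the standard simplex. -/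
theorem stdSimplex_exists_fixedPoint [Nonempty I] (f : (I → ℝ) → I → ℝ)
    (hf : ContinuousOn f (stdSimplex ℝ I)) (hmaps : Set.MapsTo f (stdSimplex ℝ I) (stdSimplex ℝ I)) :
    ∃ x ∈ stdSimplex ℝ I, f x = x := by
  -- it is enough to have `x ≤ f x`, since both sides have the same sum
  suffices ∃ x ∈ stdSimplex ℝ I, ∀ i, x i ≤ f x i by
    obtain ⟨x, hx, hle⟩ := this
    refine ⟨x, hx, funext fun i => ?_⟩
    have := (Finset.sum_eq_sum_iff_of_le (fun i _ => hle i)).1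
      (hx.2.trans (hmaps hx).2.symm) i (Finset.mem_univ i)
    exact this.symm
  rcases subsingleton_or_nontrivial I with hI | hI
  · obtain ⟨i⟩ := ‹Nonempty I›
    have hx := single_mem_stdSimplex ℝ i
    refine ⟨_, hx, fun j => ?_⟩
    have h1 := hx.2
    have h2 := (hmaps hx).2
    rw [Fintype.sum_subsingleton _ j] at h1 h2
    rw [h1, h2]
  -- Since `x` and `f x` have equal sums, some coordinate does not decrease; it serves as the
  -- colour.
  have hcolour : ∀ x : I → ℝ, ∃ i, x ∈ stdSimplex ℝ I → x i ≤ f x i := by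
    intro x
    by_contra! hcon
    obtain ⟨i⟩ := ‹Nonempty I›
    have hx := (hcon i).1
    have : ∑ i, f x i < ∑ i, x i :=
      Finset.sum_lt_sum_of_nonempty Finset.univ_nonempty fun i _ => (hcon i).2
    rw [hx.2, (hmaps hx).2] at this
    exact this.false
  choose col hcol using hcolour
  set n := Fintype.card I with hn
  let sc : ℕ → (I → ℕ) → I → ℝ := fun N x k => (x k : ℝ) / (N + 1)
  have hN : ∀ N : ℕ, (0 : ℝ) < N + 1 := fun N => by positivity
  -- Grids of size `N + 1` avoid division by zero.
  choose x hxsum hxclose hx using fun N : ℕ =>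
    Scarf.exists_close_points (I := I) (N + 1) (fun x => col (sc N x))
  have hmem : ∀ N i, sc N (x N i) ∈ stdSimplex ℝ I := by
    intro N i
    refine ⟨fun k => by positivity, ?_⟩
    simp only [sc]
    rw [← Finset.sum_div, ← Nat.cast_sum, hxsum]
    push_cast
    exact div_self (hN N).ne'
  have hbound : ∀ N i, sc N (x N i) i ≤ f (sc N (x N i)) i + n / (N + 1) := by
    intro N i
    have h0 : (0 : ℝ) ≤ n / (N + 1) := by positivity
    have h1 := (hmaps (hmem N i)).1 i
    rcases hx N i with h | h
    · have := hcol _ (hmem N i)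
      rw [h] at this
      linarith
    · have : sc N (x N i) i ≤ n / (N + 1) := by
        simp only [sc]
        gcongr
      linarith
  obtain ⟨i₀⟩ := ‹Nonempty I›
  obtain ⟨z, hz, φ, hφ, hlim⟩ :=
    (isCompact_stdSimplex ℝ I).tendsto_subseq fun N => hmem N i₀
  have hzero : Tendsto (fun N : ℕ => (n : ℝ) / (φ N + 1)) atTop (𝓝 0) := by
    have := (tendsto_one_div_add_atTop_nhds_zero_nat (𝕜 := ℝ)).const_mul (n : ℝ)
    rw [mul_zero] at this
    refine (this.comp hφ.tendsto_atTop).congr fun N => ?_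
    simp [div_eq_mul_inv]
  have hlim' : ∀ i, Tendsto (fun N => sc (φ N) (x (φ N) i)) atTop (𝓝 z) := by
    intro i
    rw [tendsto_pi_nhds] at hlim ⊢
    intro k
    have hd : Tendsto (fun N => sc (φ N) (x (φ N) i) k - sc (φ N) (x (φ N) i₀) k) atTop (𝓝 0) := by
      refine squeeze_zero_norm (fun N => ?_) hzero
      have h1 : (x (φ N) i k : ℝ) ≤ x (φ N) i₀ k + n := by exact_mod_cast hxclose (φ N) i i₀ k
      have h2 : (x (φ N) i₀ k : ℝ) ≤ x (φ N) i k + n := by exact_mod_cast hxclose (φ N) i₀ i k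
      simp only [sc]
      rw [← sub_div, Real.norm_eq_abs, abs_div, abs_of_pos (hN (φ N))]
      gcongr
      rw [abs_le]
      constructor <;> linarith
    simpa using hd.add (hlim k)
  refine ⟨z, hz, fun i => ?_⟩
  have hfl : Tendsto (fun N => f (sc (φ N) (x (φ N) i))) atTop (𝓝 (f z)) :=
    (hf z hz).tendsto.comp (tendsto_nhdsWithin_iff.2 ⟨hlim' i, .of_forall fun N => hmem _ _⟩)
  have h1 := tendsto_pi_nhds.1 (hlim' i) i
  have h2 := (tendsto_pi_nhds.1 hfl i).add hzero
  rw [add_zero] at h2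
  exact le_of_tendsto_of_tendsto' h1 h2 fun N => hbound (φ N) i

/-- The **Knaster–Kuratowski–Mazurkiewicz lemma** for the standard simplex. -/
theorem stdSimplex_exists_mem_forall [Nonempty I] (B : I → Set (I → ℝ))
    (hB : ∀ i, IsClosed (B i)) (hcover : ∀ x ∈ stdSimplex ℝ I, ∃ i, 0 < x i ∧ x ∈ B i) :
    ∃ x ∈ stdSimplex ℝ I, ∀ i, x ∈ B i := by
  -- Needed because `Metric.infDist` to the empty set is `0`. The cover at vertex `i` can only use
  -- `B i`.
  have hne : ∀ i, (B i).Nonempty := by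
    intro i
    obtain ⟨j, hj, hjB⟩ := hcover _ (single_mem_stdSimplex ℝ i)
    by_cases hij : j = i
    · exact ⟨_, hij ▸ hjB⟩
    · simp [hij] at hj
  by_contra! hcon
  let d : (I → ℝ) → I → ℝ := fun x i => Metric.infDist x (B i)
  have hd : ∀ x i, d x i = 0 ↔ x ∈ B i := fun x i =>
    ((hB i).mem_iff_infDist_zero (hne i)).symm
  have hd0 : ∀ x i, 0 ≤ d x i := fun x i => Metric.infDist_nonneg
  have hpos : ∀ x ∈ stdSimplex ℝ I, 0 < ∑ i, d x i := by
    intro x hx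
    obtain ⟨i, hi⟩ := hcon x hx
    exact Finset.sum_pos' (fun i _ => hd0 x i)
      ⟨i, Finset.mem_univ i, lt_of_le_of_ne (hd0 x i) fun h => hi ((hd x i).1 h.symm)⟩
  have hcont : ∀ i, Continuous fun x => d x i := fun i => Metric.continuous_infDist_pt _
  -- A fixed point of the normalised distances has `x i = 0` whenever `x ∈ B i`, which contradicts
  -- the cover.
  obtain ⟨x, hx, hfx⟩ := stdSimplex_exists_fixedPoint (fun x i => d x i / ∑ k, d x k)
    (continuousOn_pi.2 fun i => (hcont i).continuousOn.div
      (continuous_finsetSum _ fun k _ => hcont k).continuousOn fun x hx => (hpos x hx).ne')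
    (fun x hx => ⟨fun i => div_nonneg (hd0 x i) (hpos x hx).le, by
      rw [← Finset.sum_div, div_self (hpos x hx).ne']⟩)
  obtain ⟨i, hi, hiB⟩ := hcover x hx
  have := congrFun hfx i
  simp only [(hd x i).2 hiB, zero_div] at this
  exact hi.ne this

end Brouwer

/-- **Fan's KKM lemma** for closed subsets of a compact set. -/
theorem exists_mem_forall_of_kkm {E : Type*} [AddCommGroup E] [Module ℝ E] [TopologicalSpace E]
    [ContinuousAdd E] [ContinuousSMul ℝ E] {K : Set E} (hK : IsCompact K) (hconv : Convex ℝ K)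
    (hne : K.Nonempty)
    (A : E → Set E) (hA : ∀ y ∈ K, IsClosed (A y))
    (hcover : ∀ (s : Finset E), (↑s ⊆ K) → ∀ t : E → ℝ, (∀ y ∈ s, 0 < t y) → ∑ y ∈ s, t y = 1 →
      ∃ y ∈ s, ∑ y ∈ s, t y • y ∈ A y) :
    ∃ x ∈ K, ∀ y ∈ K, x ∈ A y := by
  classical
  suffices (K ∩ ⋂ y : K, A y).Nonempty by
    obtain ⟨x, hxK, hx⟩ := this
    exact ⟨x, hxK, fun y hy => Set.mem_iInter.1 hx ⟨y, hy⟩⟩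
  refine hK.inter_iInter_nonempty _ (fun y => hA y y.2) fun s => ?_
  rcases s.eq_empty_or_nonempty with rfl | hs
  · simpa using hne
  have : Nonempty s := hs.to_subtype
  let p : (s → ℝ) → E := fun t => ∑ y, t y • ((y : K) : E)
  have hp : Continuous p := continuous_finsetSum _ fun y _ =>
    (continuous_apply y).smul continuous_const
  obtain ⟨t, ht, hmem⟩ := stdSimplex_exists_mem_forall (fun y : s => p ⁻¹' A (y : K))
    (fun y => (hA _ (y : K).2).preimage hp) (by
      intro t ht
      let emb : s ↪ E := ⟨fun y => ((y : K) : E), fun a b h => Subtype.ext (Subtype.ext h)⟩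
      -- `hcover` takes positive weights on `E`, so zero weights are dropped and `t` is extended by
      -- `0`.
      let supp : Finset s := Finset.univ.filter fun y => 0 < t y
      let τ : E → ℝ := Function.extend emb t 0
      have hτ : ∀ y, τ (emb y) = t y := fun y => emb.injective.extend_apply t 0 y
      have hzero : ∀ y ∉ supp, t y = 0 := fun y hy =>
        le_antisymm (by simpa [supp] using hy) (ht.1 y)
      have hsum : ∑ y ∈ supp.map emb, τ y • y = p t := by
        rw [Finset.sum_map]
        simp only [hτ]
        exact Finset.sum_subset (Finset.subset_univ _) fun y _ hy => by rw [hzero y hy, zero_smul]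
      obtain ⟨y, hy, hyA⟩ := hcover (supp.map emb) (by
          intro y hy
          obtain ⟨a, -, rfl⟩ := Finset.mem_map.1 hy
          exact (a : K).2) τ (by
          intro y hy
          obtain ⟨a, ha, rfl⟩ := Finset.mem_map.1 hy
          rw [hτ]
          exact (Finset.mem_filter.1 ha).2) (by
          rw [Finset.sum_map, ← ht.2]
          simp only [hτ]
          exact Finset.sum_subset (Finset.subset_univ _) fun y _ hy => hzero y hy)
      obtain ⟨a, ha, rfl⟩ := Finset.mem_map.1 hy
      exact ⟨a, (Finset.mem_filter.1 ha).2, by rw [hsum] at hyA; exact hyA⟩)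
  refine ⟨p t, hconv.sum_mem (fun y _ => ht.1 y) ht.2 fun y _ => (y : K).2, ?_⟩
  exact Set.mem_iInter₂.2 fun y hy => hmem ⟨y, hy⟩

/-! ### Vector equilibria -/

namespace WeakVectorEquilibrium

-- Cone arithmetic and `C`-convexity

section Cone

variable {Z : Type v} [AddCommGroup Z] [Module ℝ Z] [TopologicalSpace Z] [IsTopologicalAddGroup Z]
  {C : Set Z}

/-- `interior C + C` is open and contained in `C + C = C`. -/
theorem IsSolidPointedConvexCone.sub_mem_neg_interior (hC : IsSolidPointedConvexCone C) {a c : Z}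
    (ha : a ∈ -interior C) (hc : c ∈ C) : a - c ∈ -interior C := by
  have : interior C + C ⊆ interior C := by
    simpa only [hC.add_eq] using subset_interior_add_left (s := C) (t := C)
  have h := this (Set.add_mem_add (Set.mem_neg.1 ha) hc)
  rw [Set.mem_neg, neg_sub', sub_neg_eq_add]
  exact h

omit [IsTopologicalAddGroup Z] in
theorem IsSolidPointedConvexCone.add_mem (hC : IsSolidPointedConvexCone C) {a c : Z}
    (ha : a ∈ C) (hc : c ∈ C) : a + c ∈ C := by
  have := Set.add_mem_add ha hc
  rwa [hC.add_eq] at this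

omit [IsTopologicalAddGroup Z] in
theorem IsSolidPointedConvexCone.smul_mem_neg_interior [ContinuousSMul ℝ Z]
    (hC : IsSolidPointedConvexCone C) {a : Z}
    (ha : a ∈ -interior C) {t : ℝ} (ht : 0 < t) : t • a ∈ -interior C := by
  rw [Set.mem_neg, ← smul_neg]
  have hsub : t • C ⊆ C := by
    rintro _ ⟨c, hc, rfl⟩
    exact hC.smul_mem c hc t ht.le
  exact interior_mono hsub (interior_smul₀ ht.ne' C ▸ Set.smul_mem_smul_set (Set.mem_neg.1 ha))

theorem CConvexOn.mem_neg_interior [ContinuousSMul ℝ Z] {X : Type u} [AddCommGroup X] [Module ℝ X]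
    (hC : IsSolidPointedConvexCone C) {K : Set X} {f : X → Z} (hf : CConvexOn C K f)
    {x y : X} (hx : x ∈ K) (hy : y ∈ K) (hfx : f x ∈ -interior C) (hfy : f y ∈ -C) {t : ℝ}
    (ht : 0 < t) (ht1 : t ≤ 1) : f (t • x + (1 - t) • y) ∈ -interior C := by
  have h := hC.sub_mem_neg_interior (hC.smul_mem_neg_interior hfx ht)
    (hC.add_mem (hC.smul_mem _ (Set.mem_neg.1 hfy) (1 - t) (by linarith))
      (hf x hx y hy t ht.le ht1))
  convert h using 1
  rw [smul_neg]
  abel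

theorem CConvexOn.convex_setOf_mem_neg_interior [ContinuousSMul ℝ Z] {X : Type u} [AddCommGroup X]
    [Module ℝ X] (hC : IsSolidPointedConvexCone C) {K : Set X} (hK : Convex ℝ K) {f : X → Z}
    (hf : CConvexOn C K f) : Convex ℝ {y | y ∈ K ∧ f y ∈ -interior C} := by
  rintro x ⟨hx, hfx⟩ y ⟨hy, hfy⟩ a b ha hb hab
  refine ⟨hK hx hy ha hb hab, ?_⟩
  obtain rfl : b = 1 - a := by linarith
  rcases ha.eq_or_lt with rfl | ha
  · simpa using hfy
  · exact hf.mem_neg_interior hC hx hy hfx (Set.neg_subset_neg.2 interior_subset hfy) ha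
      (by linarith)

end Cone

-- Closedness conditions in terms of nets

section Closedness

variable {E : Type u} {Z : Type v} [TopologicalSpace E] [AddCommGroup Z] [Module ℝ Z]
  [TopologicalSpace Z] [IsTopologicalAddGroup Z] {C : Set Z} {K : Set E} {f : E → Z}

theorem CUpperSemicontinuousOn.netStableOn (hC : IsSolidPointedConvexCone C)
    (h : CUpperSemicontinuousOn C K f) : NetStableOn C K f := by
  intro ι _ _ _ a ha x hx hlim hfa hfx
  obtain ⟨U, hU, hUf⟩ := h x hx _ (isOpen_interior.neg.mem_nhds hfx)
  obtain ⟨i, hi⟩ := (hlim.eventually_mem hU).exists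
  obtain ⟨b, hb, c, hc, hbc⟩ := hUf (a i) ⟨hi, ha i⟩
  exact hfa i (hbc ▸ hC.sub_mem_neg_interior hb hc)

theorem NetMajorizedOn.netStableOn (hC : IsSolidPointedConvexCone C)
    (h : NetMajorizedOn C K f) : NetStableOn C K f := by
  intro ι _ _ _ a ha x hx hlim hfa hfx
  obtain ⟨b, z, hb, hab, hz⟩ := h x hx ι a ha hlim
  -- The limit `z` lies in `f x - C`, so `-interior C` is a neighbourhood of it and some `b i`
  -- enters; then `f (a i) ∈ b i - C` follows.
  have hzC : z ∈ -interior C := by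
    have := hC.sub_mem_neg_interior hfx hz
    rwa [sub_sub_cancel] at this
  obtain ⟨i, hi⟩ := (hb.eventually_mem (isOpen_interior.neg.mem_nhds hzC)).exists
  have := hC.sub_mem_neg_interior hi (Set.mem_neg.1 (hab i))
  rw [neg_sub, sub_sub_cancel] at this
  exact hfa i this

theorem ClosednessCondition.netStableOn (hC : IsSolidPointedConvexCone C)
    (h : ClosednessCondition C K f) : NetStableOn C K f := by
  rcases h with h | h | h
  exacts [h, h.netStableOn hC, h.netStableOn hC]

omit [Module ℝ Z] [IsTopologicalAddGroup Z] in
theorem NetStableOn.isClosed (h : NetStableOn C K f) {W : Set E} (hW : IsClosed W) (hWK : W ⊆ K) :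
    IsClosed {x | x ∈ W ∧ f x ∉ -interior C} := by
  refine isClosed_of_closure_subset fun x hx => ?_
  have hxW : x ∈ W := hW.closure_subset_iff.2 (fun y hy => hy.1) hx
  refine ⟨hxW, ?_⟩
  have hpt : ∀ U : {U : Set E // U ∈ 𝓝 x}, ∃ y ∈ U.1, y ∈ W ∧ f y ∉ -interior C := fun U =>
    mem_closure_iff_nhds.1 hx U.1 U.2
  choose a haU ha using hpt
  -- Neighbourhoods under reverse inclusion index a net tending to `x`, in the universe that
  -- `NetStableOn` requires.
  let ι := {U : Set E // U ∈ 𝓝 x}ᵒᵈ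
  have : IsDirectedOrder ι := ⟨fun U V =>
    ⟨(OrderDual.toDual ⟨(OrderDual.ofDual U).1 ∩ (OrderDual.ofDual V).1,
      inter_mem (OrderDual.ofDual U).2 (OrderDual.ofDual V).2⟩ : ι),
      fun _ hy => hy.1, fun _ hy => hy.2⟩⟩
  have : Nonempty ι := ⟨OrderDual.toDual ⟨Set.univ, univ_mem⟩⟩
  refine h ι (fun U => a (OrderDual.ofDual U)) (fun U => hWK (ha _).1) x
    (hWK hxW) (fun U hU => ?_) fun U => (ha _).2
  rw [mem_map]
  filter_upwards [eventually_ge_atTop (OrderDual.toDual ⟨U, hU⟩ : ι)] with V hV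
  exact hV (haU _)

end Closedness

/-- Convex closed sets are weakly closed, and by reflexivity every weak-star limit in the bidual
comes from `X`. -/
theorem isCompact_toWeakSpace_image {X : Type u} [NormedAddCommGroup X] [NormedSpace ℝ X]
    (hX : IsReflexiveSpace X) {S : Set X} (hconv : Convex ℝ S) (hclosed : IsClosed S)
    (hbdd : Bornology.IsBounded S) : IsCompact (toWeakSpace ℝ X '' S) := by
  have hcl : closure (toWeakSpace ℝ X '' S) = toWeakSpace ℝ X '' S := by
    rw [← hconv.toWeakSpace_closure ℝ, hclosed.closure_eq]
  rw [← hcl]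
  refine NormedSpace.isCompact_closure_of_isBounded ℝ X _ ?_ fun φ _ => ?_
  · rwa [Set.preimage_image_eq _ (toWeakSpace ℝ X).injective]
  · obtain ⟨x, hx⟩ := hX (WeakDual.toStrongDual φ)
    exact ⟨toWeakSpace ℝ X x, hx⟩

/-- In a reflexive space, a vector equilibrium exists on every nonempty bounded closed convex set. -/
theorem exists_of_isBounded {X : Type u} {Z : Type v}
    [NormedAddCommGroup X] [NormedSpace ℝ X] (hX : IsReflexiveSpace X)
    [AddCommGroup Z] [Module ℝ Z] [TopologicalSpace Z] [IsTopologicalAddGroup Z]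
    [ContinuousSMul ℝ Z] {C : Set Z} (hC : IsSolidPointedConvexCone C) {K : Set X}
    (hKconv : Convex ℝ K) {F : X → X → X → Z}
    (h_closed : ∀ y ∈ K, WeakClosednessCondition C K (fun x => F x y x))
    (h_convex : ∀ x ∈ K, CConvexOn C K (fun y => F x y x))
    (h_diag : ∀ x ∈ K, F x x x ∉ -interior C) {B : Set X} (hBK : B ⊆ K) (hBne : B.Nonempty)
    (hBconv : Convex ℝ B) (hBclosed : IsClosed B) (hBbdd : Bornology.IsBounded B) :
    ∃ x₀ ∈ B, ∀ y ∈ B, F x₀ y x₀ ∉ -interior C := by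
  let e := toWeakSpace ℝ X
  have hcomp : IsCompact (e '' B) := isCompact_toWeakSpace_image hX hBconv hBclosed hBbdd
  have hcl : IsClosed (e '' B) := by
    have := hBconv.toWeakSpace_closure ℝ
    rw [hBclosed.closure_eq] at this
    exact closure_eq_iff_isClosed.1 this.symm
  have hconvE : Convex ℝ (e '' B) := hBconv.linear_image e.toLinearMap
  obtain ⟨w, ⟨x, hx, rfl⟩, hw⟩ := exists_mem_forall_of_kkm hcomp hconvE (hBne.image e)
    (fun y => {x | x ∈ e '' B ∧ F (e.symm x) (e.symm y) (e.symm x) ∉ -interior C})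
    (by
      rintro _ ⟨y, hy, rfl⟩
      rw [e.symm_apply_apply]
      exact (ClosednessCondition.netStableOn hC (h_closed y (hBK hy))).isClosed hcl
        (Set.image_mono hBK))
    (by
      intro s hs t ht hsum
      have hmem : ∑ y ∈ s, t y • y ∈ e '' B :=
        hconvE.sum_mem (fun y hy => (ht y hy).le) hsum fun y hy => hs hy
      obtain ⟨x, hx, hxs⟩ := hmem
      by_contra! hcon
      refine h_diag x (hBK hx) ?_
      -- The `y` with `F x y x ∈ -interior C` form a convex set containing the points of `s`, hence
      -- also `x`.
      have key : ∑ y ∈ s, t y • e.symm y ∈ {y | y ∈ K ∧ F x y x ∈ -interior C} := by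
        refine ((h_convex x (hBK hx)).convex_setOf_mem_neg_interior hC hKconv).sum_mem
          (fun y hy => (ht y hy).le) hsum fun y hy => ?_
        obtain ⟨y', hy', rfl⟩ := hs hy
        have := hcon _ hy
        rw [← hxs] at this
        simp only [Set.mem_ofPred_eq, not_and, not_not, e.symm_apply_apply] at this ⊢
        exact ⟨hBK hy', this ⟨x, hx, rfl⟩⟩
      have hsx : ∑ y ∈ s, t y • e.symm y = x := by
        rw [← e.symm_apply_apply x, hxs, map_sum]
        simp
      rw [hsx] at key
      exact key.2)
  refine ⟨x, hx, fun y hy => ?_⟩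
  have := (hw (e y) ⟨y, hy, rfl⟩).2
  rwa [e.symm_apply_apply, e.symm_apply_apply] at this
end WeakVectorEquilibrium

/-- The trifunction `F` is a total function of which only the values on `K × K × K` are used. -/
theorem theorem4p3 {X : Type u} {Z : Type v}
    [NormedAddCommGroup X] [NormedSpace ℝ X] [CompleteSpace X]
    (hX : WeakVectorEquilibrium.IsReflexiveSpace X)
    [AddCommGroup Z] [Module ℝ Z] [TopologicalSpace Z] [IsTopologicalAddGroup Z]
    [ContinuousSMul ℝ Z] [T2Space Z]
    (C : Set Z) (hC : WeakVectorEquilibrium.IsSolidPointedConvexCone C)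
    (K : Set X) (hKne : K.Nonempty) (hKconv : Convex ℝ K) (hKclosed : IsClosed K)
    (F : X → X → X → Z)
    (h_closed : ∀ y ∈ K, WeakVectorEquilibrium.WeakClosednessCondition C K (fun x => F x y x))
    (h_convex : ∀ x ∈ K, WeakVectorEquilibrium.CConvexOn C K (fun y => F x y x))
    (h_diag : ∀ x ∈ K, F x x x ∈ (-C) \ (-interior C))
    (h_coercive : ∃ r : ℝ, 0 < r ∧ (K ∩ Metric.closedBall 0 r).Nonempty ∧
      ∀ x ∈ K, ‖x‖ = r → ∃ y₀ ∈ K, ‖y₀‖ < r ∧ F x y₀ x ∈ -C) :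
    ∃ x₀ ∈ K, ∀ y ∈ K, F x₀ y x₀ ∉ -interior C := by
  obtain ⟨r, hr, hne, hcoer⟩ := h_coercive
  obtain ⟨x₀, ⟨hx₀, hx₀r⟩, hsol⟩ := WeakVectorEquilibrium.exists_of_isBounded hX hC hKconv
    h_closed h_convex (fun x hx => (h_diag x hx).2) Set.inter_subset_left hne
    (hKconv.inter (convex_closedBall 0 r)) (hKclosed.inter Metric.isClosed_closedBall)
    (Metric.isBounded_closedBall.subset Set.inter_subset_right)
  rw [mem_closedBall_zero_iff] at hx₀r
  obtain ⟨y₀, hy₀, hy₀r, hFy₀⟩ : ∃ y₀ ∈ K, ‖y₀‖ < r ∧ F x₀ y₀ x₀ ∈ -C := by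
    rcases hx₀r.lt_or_eq with hlt | heq
    · exact ⟨x₀, hx₀, hlt, (h_diag x₀ hx₀).1⟩
    · exact hcoer x₀ hx₀ heq
  refine ⟨x₀, hx₀, fun y hy hFy => ?_⟩
  -- As `y₀` is in the open ball, points of the segment near `y₀` lie in the ball; `t > 0` keeps
  -- their values in `-interior C`.
  have hlim : Tendsto (fun t : ℝ => t • y + (1 - t) • y₀) (𝓝[>] 0) (𝓝 y₀) := by
    have : Continuous fun t : ℝ => t • y + (1 - t) • y₀ := by fun_prop
    simpa using (this.tendsto 0).mono_left nhdsWithin_le_nhds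
  have hball : ∀ᶠ t : ℝ in 𝓝[>] 0, t • y + (1 - t) • y₀ ∈ Metric.ball (0 : X) r :=
    hlim.eventually_mem (Metric.isOpen_ball.mem_nhds (mem_ball_zero_iff.2 hy₀r))
  obtain ⟨t, ht, ht0, ht1⟩ :=
    (hball.and (Ioc_mem_nhdsGT (zero_lt_one (α := ℝ)))).exists
  exact hsol _ ⟨hKconv hy hy₀ ht0.le (by linarith) (by ring), Metric.ball_subset_closedBall ht⟩
    ((h_convex x₀ hx₀).mem_neg_interior hC hy hy₀ hFy hFy₀ ht0 ht1)
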